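/- **Definitions.** An *sc-Banach space* is a real Banach space $E$ with a nested sequence of Banach spaces $E=E_0\supseteq E_1\supseteq E_2\supseteq\cdots$ such that the inclusions $E_n\hookrightarrow E_m$, $m<n$, are compact and $E_\infty=\bigcap_m E_m$ is dense in every $E_m$; it is an *sc-Hilbert space* if the norm of $E_0$ comes from an inner product (nothing is required of $E_m$, $m\ge 1$). $\mathbb R^n$ carries the constant structure, sums carry $(E\oplus F)_m=E_m\oplus F_m$, and $(E^1)_m=E_{m+1}$. A *partial quadrant* $C\subseteq W$ is a subset that some linear sc-isomorphism $W\cong\mathbb R^n\oplus Q$ maps onto $[0,\infty)^n\oplus Q$. For $U$ open in a partial quadrant of $E$ put $U_m=U\cap E_m$ and $TU=U^1\oplus E$. A map $f:U\to F$ is $sc^0$ if, for all $m$, it restricts to a continuous map $U_m\to F_m$. It is $sc^1$ if it is $sc^0$ and for every $x\in U_1$ there is $Df(x)\in\mathcal L(E_0,F_0)$ with $\|f(x+h)-f(x)-Df(x)h\|_0/\|h\|_1\to0$ as $\|h\|_1\to0$ (with $x+h\in U_1$), such that $Tf:TU\to TF$, $Tf(x,h)=(f(x),Df(x)h)$, is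 $sc^0$. It is $sc^{k+1}$ if it is $sc^1$ and $Tf$ is $sc^k$, and *sc-smooth* if it is $sc^k$ for all $k$. An *sc-smooth splicing* $\mathcal S=(\pi,E,V)$ consists of a relatively open subset $V$ of a partial quadrant in an sc-Banach space $W$, an sc-Banach space $E$, and bounded linear projections $\pi_v:E\to E$, $v\in V$, such that $V\oplus E\to E$, $(v,e)\mapsto\pi_v(e)$, is sc-smooth. Its *splicing core* is $K^{\mathcal S}=\{(v,e)\in V\oplus E:\pi_v(e)=e\}$; it is *built on sc-Hilbert spaces* if $W$ and $E$ are sc-Hilbert spaces. A map $f$ from an open subset $O$ of $K^{\mathcal S}$ to an sc-Banach space, or to an open subset of a splicing core, is *sc-smooth* if $(v,e)\mapsto f(v,\pi_v(e))$ is sc-smooth on $\{(v,e)\in V\oplus E:(v,\pi_v(e))\in O\}$. An *M-polyfold* is a second countable metrizable space $X$ with a maximal atlas of charts, a chart being a homeomorphism from an open subset of $X$ onto an open subset of a splicing core, such that all transition maps are sc-smooth. A function $f:X\to\mathbb R$ is *sc-smooth* if every point of $X$ lies in the domain of a chart $\varphi:U\to O$ of the atlas for which $f\circ\varphi^{-1}:O\to\mathbb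 R$ is sc-smooth. **Theorem.** Let $X$ be an M-polyfold that is covered by the domains of charts of its atlas whose local models are splicing cores built on sc-Hilbert spaces. Let $(U_\lambda)_{\lambda\in\Lambda}$ be an open covering of $X$. Then there is an sc-smooth partition of unity $(\beta_\lambda)_{\lambda\in\Lambda}$ subordinate to it: the functions $\beta_\lambda:X\to[0,1]$ are sc-smooth, the family of their supports is locally finite, the (closed) support of $\beta_\lambda$ is contained in $U_\lambda$ for every $\lambda\in\Lambda$, and $\sum_{\lambda\in\Lambda}\beta_\lambda(x)=1$ for all $x\in X$. -/

import Mathlib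

open Set Topology

universe u v w

/-- A nested sequence `E₀ ⊇ E₁ ⊇ E₂ ⊇ ⋯` of real Banach spaces with bounded inclusions. The
inclusions are recorded as injective bounded linear maps `E (m+1) → E m`. -/
structure BanachScale : Type (u + 1) where
  level : ℕ → Type u
  [normedAddCommGroup : ∀ m, NormedAddCommGroup (level m)]
  [normedSpace : ∀ m, NormedSpace ℝ (level m)]
  [completeSpace : ∀ m, CompleteSpace (level m)]
  incl : ∀ m, level (m + 1) →L[ℝ] level m
  incl_injective : ∀ m, Function.Injective (incl m)

namespace BanachScale

attribute [instance] BanachScale.normedAddCommGroup BanachScale.normedSpace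
  BanachScale.completeSpace

/-- The inclusion of `E m` into `E 0`. -/
def emb (E : BanachScale.{u}) : ∀ m, E.level m →L[ℝ] E.level 0
  | 0 => ContinuousLinearMap.id ℝ (E.level 0)
  | m + 1 => (emb E m).comp (E.incl m)

/-- The space `E_∞ = ⋂ m, E m`, as a subset of `E 0`. -/
def smoothPoints (E : BanachScale.{u}) : Set (E.level 0) := ⋂ m, range (E.emb m)

/-- The scale is an sc-structure on the Banach space `E 0` (in other words, an sc-Banach space):
the inclusions are compact and `E_∞` is dense in every level.  Compactness of all the inclusions
`E n → E m`, `m < n`, is the same as compactness of the one-step inclusions. -/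
structure IsSc (E : BanachScale.{u}) : Prop where
  compact : ∀ m, IsCompactOperator (E.incl m)
  dense : ∀ m, Dense (E.emb m ⁻¹' E.smoothPoints)

/-- The scale sits on a Hilbert space: the norm of `E 0` (and of `E 0` only) comes from an
inner product. -/
def IsHilbert (E : BanachScale.{u}) : Prop :=
  ∃ I : InnerProductSpace ℝ (E.level 0), I.toNormedSpace = E.normedSpace 0

/-- The constant scale `E m = A`. -/
noncomputable abbrev const (A : Type u) [NormedAddCommGroup A] [NormedSpace ℝ A] [CompleteSpace A] :
    BanachScale.{u} where
  level _ := A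
  incl _ := ContinuousLinearMap.id ℝ A
  incl_injective _ := Function.injective_id

/-- The direct sum, `(E ⊕ F) m = E m ⊕ F m`. -/
noncomputable abbrev prod (E : BanachScale.{u}) (F : BanachScale.{v}) : BanachScale.{max u v} where
  level m := E.level m × F.level m
  incl m := (E.incl m).prodMap (F.incl m)
  incl_injective m := (E.incl_injective m).prodMap (F.incl_injective m)

/-- The shifted scale `E¹`, `(E¹) m = E (m + 1)`. -/
abbrev shift (E : BanachScale.{u}) : BanachScale.{u} where
  level m := E.level (m + 1)
  incl m := E.incl (m + 1)
  incl_injective m := E.incl_injective (m + 1)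

/-- The tangent scale `TE = E¹ ⊕ E`. -/
noncomputable abbrev tangent (E : BanachScale.{u}) : BanachScale.{u} := E.shift.prod E

/-- The tangent `TU = U¹ ⊕ E` of a subset `U` of `E`. -/
def tangentSet {E : BanachScale.{u}} (U : Set (E.level 0)) : Set (E.tangent.level 0) :=
  {p | E.emb 1 p.1 ∈ U}

/-- A linear sc-isomorphism: a linear bijection that is bounded with bounded inverse on all
levels. -/
structure ScIso (E : BanachScale.{u}) (F : BanachScale.{v}) where
  toEquiv : ∀ m, E.level m ≃L[ℝ] F.level m
  comm : ∀ m (x : E.level (m + 1)), F.incl m (toEquiv (m + 1) x) = toEquiv m (E.incl m x)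

section Maps

variable {E : BanachScale.{u}} {F : BanachScale.{v}}

/-- The map `f : U → F` is `sc⁰`: for every `m` it maps `U m = U ∩ E m` into `F m`, and the induced
map `U m → F m` is continuous. -/
def ScZeroOn (U : Set (E.level 0)) (f : E.level 0 → F.level 0) : Prop :=
  ∀ m, ∃ g : E.level m → F.level m, ContinuousOn g (E.emb m ⁻¹' U) ∧
    ∀ x, E.emb m x ∈ U → F.emb m (g x) = f (E.emb m x)

/-- `g : TU → TF` is a tangent map of `f : U → F`: there are linearizations `D x ∈ L(E 0, F 0)` for
`x ∈ U 1` such that `‖f (x + h) - f x - D x h‖₀ / ‖h‖₁ → 0` as `‖h‖₁ → 0`, `x + h ∈ U 1`, and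
`g (x, h) = (f x, D x h)`. -/
def IsTangentMapOn (U : Set (E.level 0)) (f : E.level 0 → F.level 0)
    (g : E.tangent.level 0 → F.tangent.level 0) : Prop :=
  ∃ D : E.level 1 → (E.level 0 →L[ℝ] F.level 0),
    (∀ x : E.level 1, E.emb 1 x ∈ U →
      HasFDerivWithinAt (fun y : E.level 1 => f (E.emb 1 y)) ((D x).comp (E.emb 1))
        (E.emb 1 ⁻¹' U) x) ∧
    ∀ (x : E.level 1) (h : E.level 0), E.emb 1 x ∈ U →
      F.emb 1 (g (x, h)).1 = f (E.emb 1 x) ∧ (g (x, h)).2 = D x h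

end Maps

/-- The map `f : U → F` is of class `sc^k`. It is used for `U` open in a partial quadrant, where
the tangent map is unique. -/
def ScClassOn : ∀ (_k : ℕ) {E : BanachScale.{u}} {F : BanachScale.{v}} (_U : Set (E.level 0))
    (_f : E.level 0 → F.level 0), Prop
  | 0, _, _, U, f => ScZeroOn U f
  | k + 1, E, F, U, f => ScZeroOn U f ∧
      ∃ g : E.tangent.level 0 → F.tangent.level 0,
        IsTangentMapOn U f g ∧ ScClassOn k (E := E.tangent) (F := F.tangent) (tangentSet U) g

/-- The map `f : U → F` is sc-smooth. -/
def ScSmoothOn {E : BanachScale.{u}} {F : BanachScale.{v}} (U : Set (E.level 0))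
    (f : E.level 0 → F.level 0) : Prop :=
  ∀ k, ScClassOn k U f

/-- `C ⊆ W` is a partial quadrant: some linear sc-isomorphism `W ≅ ℝⁿ ⊕ Q`, with `Q` an sc-Banach
space, maps `C` onto `[0, ∞)ⁿ ⊕ Q`. -/
def IsPartialQuadrant (W : BanachScale.{u}) (C : Set (W.level 0)) : Prop :=
  ∃ (n : ℕ) (Q : BanachScale.{u}) (T : ScIso W ((const (EuclideanSpace ℝ (Fin n))).prod Q)),
    Q.IsSc ∧ T.toEquiv 0 '' C = {p | ∀ i, 0 ≤ p.1 i}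

end BanachScale

/-- An sc-smooth splicing `(π, E, V)`, with `V` open in the partial quadrant `C` of `W`. Values of
`π` outside `V` are irrelevant. -/
structure ScSplicing : Type (w + 1) where
  W : BanachScale.{w}
  E : BanachScale.{w}
  isSc_W : W.IsSc
  isSc_E : E.IsSc
  C : Set (W.level 0)
  isPartialQuadrant : W.IsPartialQuadrant C
  V : Set (W.level 0)
  isOpen_V : ∃ G : Set (W.level 0), IsOpen G ∧ V = C ∩ G
  π : W.level 0 → (E.level 0 →L[ℝ] E.level 0)
  proj : ∀ v ∈ V, (π v).comp (π v) = π v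
  smooth : BanachScale.ScSmoothOn (E := W.prod E) (F := E) (V ×ˢ univ) fun p => π p.1 p.2

namespace ScSplicing

/-- The sc-Banach space `W ⊕ E`. -/
noncomputable abbrev ambient (S : ScSplicing.{w}) : BanachScale.{w} := S.W.prod S.E

/-- The splicing core `K = {(v, e) ∈ V ⊕ E | π_v e = e}`. -/
def core (S : ScSplicing.{w}) : Set (S.ambient.level 0) := {p | p.1 ∈ S.V ∧ S.π p.1 p.2 = p.2}

/-- The map `(v, e) ↦ (v, π_v e)`. -/
def retr (S : ScSplicing.{w}) (p : S.ambient.level 0) : S.ambient.level 0 := (p.1, S.π p.1 p.2)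

/-- The set `{(v, e) ∈ V ⊕ E | (v, π_v e) ∈ O}`. -/
def hat (S : ScSplicing.{w}) (O : Set (S.ambient.level 0)) : Set (S.ambient.level 0) :=
  {p | p.1 ∈ S.V ∧ S.retr p ∈ O}

/-- A map `f : O → F` on an open subset `O` of the splicing core is sc-smooth if
`(v, e) ↦ f (v, π_v e)` is sc-smooth. -/
def ScSmoothOn (S : ScSplicing.{w}) {F : BanachScale.{v}} (O : Set (S.ambient.level 0))
    (f : S.ambient.level 0 → F.level 0) : Prop :=
  BanachScale.ScSmoothOn (E := S.ambient) (F := F) (S.hat O) fun p => f (S.retr p)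

/-- The splicing (core) is built on sc-Hilbert spaces. -/
def IsHilbert (S : ScSplicing.{w}) : Prop := S.W.IsHilbert ∧ S.E.IsHilbert

end ScSplicing

/-- An M-polyfold chart of `X`: a homeomorphism from an open subset of `X` (the `source`) onto an
open subset of a splicing core (the `target`). -/
structure MPolyfoldChart (X : Type u) [TopologicalSpace X] : Type (max u (w + 1)) where
  model : ScSplicing.{w}
  map : PartialEquiv X (model.ambient.level 0)
  isOpen_source : IsOpen map.source
  isOpen_target : ∃ G : Set (model.ambient.level 0), IsOpen G ∧ map.target = model.core ∩ G
  continuousOn_map : ContinuousOn map map.source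
  continuousOn_symm : ContinuousOn map.symm map.target

namespace MPolyfoldChart

variable {X : Type u} [TopologicalSpace X]

/-- The transition map `c'.map ∘ c.map⁻¹`, defined on `c.map (source ∩ source')`, is sc-smooth. -/
def TransitionSmooth (c c' : MPolyfoldChart.{u, w} X) : Prop :=
  c.model.ScSmoothOn (F := c'.model.ambient) (c.map '' (c.map.source ∩ c'.map.source))
    fun p => c'.map (c.map.symm p)

/-- Two charts are compatible if both transition maps are sc-smooth. -/
def Compatible (c c' : MPolyfoldChart.{u, w} X) : Prop :=
  c.TransitionSmooth c' ∧ c'.TransitionSmooth c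

end MPolyfoldChart

/-- An M-polyfold structure on `X`: a maximal atlas of compatible M-polyfold charts. The
conditions on the topology of `X` are separate. -/
structure MPolyfoldStructure (X : Type u) [TopologicalSpace X] : Type (max u (w + 1)) where
  atlas : Set (MPolyfoldChart.{u, w} X)
  cover : ∀ x, ∃ c ∈ atlas, x ∈ c.map.source
  compatible : ∀ c ∈ atlas, ∀ c' ∈ atlas, c.Compatible c'
  maximal : ∀ c : MPolyfoldChart.{u, w} X, (∀ c' ∈ atlas, c.Compatible c') → c ∈ atlas

namespace MPolyfoldStructure

variable {X : Type u} [TopologicalSpace X]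

/-- The local models are splicing cores built on sc-Hilbert spaces: the domains of the charts with
such a model cover `X`. -/
def IsHilbert (P : MPolyfoldStructure.{u, w} X) : Prop :=
  ∀ x, ∃ c ∈ P.atlas, x ∈ c.map.source ∧ c.model.IsHilbert

/-- A function `f : X → ℝ` is sc-smooth if around every point there is a chart in which it is
represented by an sc-smooth function. -/
def ScSmooth (P : MPolyfoldStructure.{u, w} X) (f : X → ℝ) : Prop :=
  ∀ x, ∃ c ∈ P.atlas, x ∈ c.map.source ∧
    c.model.ScSmoothOn (F := BanachScale.const ℝ) c.map.target fun p => f (c.map.symm p)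

end MPolyfoldStructure

/-! The proof combines sc-smooth bump functions with a telescoping product.

Bump functions exist because the squared norm of a Hilbert space `E 0` is smooth. A smooth function
on `E 0`, composed with the bounded inclusions `E m → E 0`, is smooth on every level and hence
sc-smooth (`scSmoothOn_of_contDiff`), so nothing is needed of the norms of the higher levels.
Composition with the retraction `(v, e) ↦ (v, π_v e)` carries it to a splicing core. Passing between
charts requires the chain rule of sc-calculus, `ScClassOn.comp`, which rests on the compactness of
the inclusions. A closed neighbourhood inside the chart domain, available by regularity of `X`,
makes extension by zero harmless (`exists_bump`).

By second countability, countably many bumps `b n` suffice for the interiors of the sets `{b n = 1}`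
to cover `X`. The functions `b n * ∏ j < n, (1 - b j)` then sum to `1`, and they form a locally
finite family: where `b j = 1`, every term with `n > j` vanishes. No locally finite refinement of
the cover is needed. Adding up the terms assigned to the same `λ` gives the partition of unity. -/

namespace BanachScale

open Filter

/-! ### Embeddings of the levels and compactness of the inclusions. -/

section Embeddings

variable {E : BanachScale.{u}} {F : BanachScale.{v}}

theorem emb_injective (E : BanachScale.{u}) : ∀ m, Function.Injective (E.emb m)
  | 0 => Function.injective_id
  | m + 1 => (emb_injective E m).comp (E.incl_injective m)

theorem emb_one_shift (E : BanachScale.{u}) :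
    ∀ m (x : E.level (m + 1)), E.emb 1 (E.shift.emb m x) = E.emb (m + 1) x
  | 0, _ => rfl
  | m + 1, x => emb_one_shift E m (E.incl (m + 1) x)

theorem emb_prod (E : BanachScale.{u}) (F : BanachScale.{v}) :
    ∀ m (p : (E.prod F).level m), (E.prod F).emb m p = (E.emb m p.1, F.emb m p.2)
  | 0, _ => rfl
  | m + 1, p => emb_prod E F m ((E.prod F).incl m p)

theorem emb_const (A : Type u) [NormedAddCommGroup A] [NormedSpace ℝ A] [CompleteSpace A] :
    ∀ m (x : A), (const A).emb m x = x
  | 0, _ => rfl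
  | m + 1, x => emb_const A m x

theorem emb_tangent (E : BanachScale.{u}) (m : ℕ) (p : E.tangent.level m) :
    E.tangent.emb m p = (E.shift.emb m p.1, E.emb m p.2) :=
  emb_prod _ _ m p

/-- All the inclusions of the scale are compact. -/
def CompactIncl (E : BanachScale.{u}) : Prop := ∀ m, IsCompactOperator (E.incl m)

theorem CompactIncl.prod (hE : E.CompactIncl) (hF : F.CompactIncl) : (E.prod F).CompactIncl := by
  intro m
  obtain ⟨K, hK, hK'⟩ := hE m
  obtain ⟨L, hL, hL'⟩ := hF m
  refine ⟨K ×ˢ L, hK.prod hL, ?_⟩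
  exact prod_mem_nhds hK' hL'

theorem CompactIncl.tangent (hE : E.CompactIncl) : E.tangent.CompactIncl :=
  CompactIncl.prod (E := E.shift) (fun m => hE (m + 1)) hE

end Embeddings

section Basic

variable {E : BanachScale.{u}} {F : BanachScale.{v}} {U U' : Set (E.level 0)}
  {f f' : E.level 0 → F.level 0}

theorem ScZeroOn.mono (h : ScZeroOn U f) (hU : U' ⊆ U) : ScZeroOn U' f := fun m => by
  obtain ⟨g, hg, hgf⟩ := h m
  exact ⟨g, hg.mono (preimage_mono hU), fun x hx => hgf x (hU hx)⟩

theorem ScZeroOn.congr (h : ScZeroOn U f) (hf : EqOn f' f U) : ScZeroOn U f' := fun m => by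
  obtain ⟨g, hg, hgf⟩ := h m
  exact ⟨g, hg, fun x hx => (hgf x hx).trans (hf hx).symm⟩

theorem ScZeroOn.continuousOn (h : ScZeroOn U f) : ContinuousOn f U := by
  obtain ⟨g, hg, hgf⟩ := h 0
  exact ContinuousOn.congr hg fun x hx => (hgf x hx).symm

theorem ScZeroOn.comp {G : BanachScale.{w}} {V : Set (F.level 0)} {g : F.level 0 → G.level 0}
    (hg : ScZeroOn V g) (hf : ScZeroOn U f) (hUV : MapsTo f U V) : ScZeroOn U (g ∘ f) := fun m => by
  obtain ⟨a, ha, haf⟩ := hf m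
  obtain ⟨b, hb, hbg⟩ := hg m
  have hmem : ∀ x, E.emb m x ∈ U → F.emb m (a x) ∈ V := fun x hx => by
    rw [haf x hx]; exact hUV hx
  refine ⟨b ∘ a, hb.comp ha hmem, fun x hx => ?_⟩
  rw [Function.comp_apply, hbg _ (hmem x hx), haf x hx, Function.comp_apply]

theorem IsTangentMapOn.mono {g : E.tangent.level 0 → F.tangent.level 0}
    (h : IsTangentMapOn U f g) (hU : U' ⊆ U) : IsTangentMapOn U' f g := by
  obtain ⟨D, hD, hg⟩ := h
  exact ⟨D, fun x hx => (hD x (hU hx)).mono (preimage_mono hU), fun x e hx => hg x e (hU hx)⟩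

theorem IsTangentMapOn.congr {g : E.tangent.level 0 → F.tangent.level 0}
    (h : IsTangentMapOn U f g) (hf : EqOn f' f U) : IsTangentMapOn U f' g := by
  obtain ⟨D, hD, hg⟩ := h
  refine ⟨D, fun x hx => (hD x hx).congr (fun y hy => hf hy) (hf hx), fun x e hx => ?_⟩
  rw [hf hx]
  exact hg x e hx

theorem ScClassOn.scZeroOn {k : ℕ} (h : ScClassOn k U f) : ScZeroOn U f := by
  cases k with
  | zero => exact h
  | succ k => exact h.1

theorem ScClassOn.mono {k : ℕ} (h : ScClassOn k U f) (hU : U' ⊆ U) : ScClassOn k U' f := by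
  induction k generalizing E F with
  | zero => exact ScZeroOn.mono h hU
  | succ k ih =>
    obtain ⟨h0, g, hg, hk⟩ := h
    exact ⟨h0.mono hU, g, hg.mono hU, ih hk fun p hp => hU hp⟩

theorem ScClassOn.congr {k : ℕ} (h : ScClassOn k U f) (hf : EqOn f' f U) : ScClassOn k U f' := by
  cases k with
  | zero => exact ScZeroOn.congr h hf
  | succ k =>
    obtain ⟨h0, g, hg, hk⟩ := h
    exact ⟨h0.congr hf, g, hg.congr hf, hk⟩

theorem ScSmoothOn.mono (h : ScSmoothOn U f) (hU : U' ⊆ U) : ScSmoothOn U' f :=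
  fun k => (h k).mono hU

theorem ScSmoothOn.congr (h : ScSmoothOn U f) (hf : EqOn f' f U) : ScSmoothOn U f' :=
  fun k => (h k).congr hf

theorem ScSmoothOn.continuousOn (h : ScSmoothOn U f) : ContinuousOn f U :=
  ScZeroOn.continuousOn (h 0)

end Basic

/-! ### Maps that are smooth on every level. -/

section Levelwise

open scoped ContDiff

/-- A map that is smooth on all levels is sc-smooth. -/
theorem scSmoothOn_of_contDiff {E : BanachScale.{u}} {F : BanachScale.{v}} (U : Set (E.level 0))
    {f : E.level 0 → F.level 0} (a : ∀ m, E.level m → F.level m) (ha : ∀ m, ContDiff ℝ ∞ (a m))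
    (haf : ∀ m x, F.emb m (a m x) = f (E.emb m x)) : ScSmoothOn U f := by
  intro k
  suffices h : ScClassOn k univ f from h.mono (subset_univ _)
  induction k generalizing E F with
  | zero => exact fun m => ⟨a m, (ha m).continuous.continuousOn, fun x _ => haf m x⟩
  | succ k ih =>
    have hfa : f = a 0 := funext fun x => (haf 0 x).symm
    have hfd : ∀ m, Differentiable ℝ (a m) := fun m => (ha m).differentiable (by simp)
    have hff : Differentiable ℝ f := hfa ▸ hfd 0
    refine ⟨fun m => ⟨a m, (ha m).continuous.continuousOn, fun x _ => haf m x⟩,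
      fun p => (a 1 p.1, fderiv ℝ f (E.emb 1 p.1) p.2), ⟨fun x => fderiv ℝ f (E.emb 1 x),
        fun x _ => ?_, fun x h _ => ⟨haf 1 x, rfl⟩⟩, ?_⟩
    · exact ((hff (E.emb 1 x)).hasFDerivAt.comp x (E.emb 1).hasFDerivAt).hasFDerivWithinAt
    -- Level `m` of the tangent map pairs `a (m + 1)` with the derivative of `a m`, so it is again
    -- smooth on all levels.
    · refine (ih (E := E.tangent) (F := F.tangent) (tangentSet univ)
        (fun m p => (a (m + 1) p.1, fderiv ℝ (a m) (E.incl m p.1) p.2)) ?_ ?_)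
      · intro m
        have h1 : ContDiff ℝ ∞ (fderiv ℝ (a m)) := (ha m).fderiv_right (by simp)
        exact ((ha (m + 1)).comp contDiff_fst).prodMk
          ((h1.comp ((E.incl m).contDiff.comp contDiff_fst)).clm_apply contDiff_snd)
      · rintro m ⟨x, h⟩
        rw [emb_tangent, emb_tangent]
        refine Prod.ext (F.emb_injective 1 ?_) ?_
        · change F.emb 1 (F.shift.emb m (a (m + 1) x)) = F.emb 1 (a 1 (E.shift.emb m x))
          rw [emb_one_shift, haf, haf, emb_one_shift]
        · change F.emb m (fderiv ℝ (a m) (E.incl m x) h) =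
            fderiv ℝ f (E.emb 1 (E.shift.emb m x)) (E.emb m h)
          rw [emb_one_shift]
          -- Both sides are the derivative of the one map `F.emb m ∘ a m = f ∘ E.emb m`, so
          -- uniqueness of derivatives identifies them.
          have h1 := (F.emb m).hasFDerivAt.comp (E.incl m x) (hfd m (E.incl m x)).hasFDerivAt
          have h2 := (hff (E.emb m (E.incl m x))).hasFDerivAt.comp (E.incl m x)
            (E.emb m).hasFDerivAt
          rw [show F.emb m ∘ a m = f ∘ E.emb m from funext (haf m)] at h1
          exact congrArg (fun L => L h) (h1.unique h2)

/-- A linear map that is bounded on all levels is sc-smooth. -/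
theorem scSmoothOn_of_clm {E : BanachScale.{u}} {F : BanachScale.{v}} (U : Set (E.level 0))
    {f : E.level 0 → F.level 0} (a : ∀ m, E.level m →L[ℝ] F.level m)
    (haf : ∀ m x, F.emb m (a m x) = f (E.emb m x)) : ScSmoothOn U f :=
  scSmoothOn_of_contDiff U (fun m => a m) (fun m => (a m).contDiff) haf

end Levelwise

end BanachScale

namespace BanachScale

open Filter

/-! ### The chain rule of sc-calculus. -/

section ChainRule

/-- If `(y, k) ↦ D y k` is continuous, the operators `D y` are bounded uniformly for `y` near a
point. -/
theorem eventually_norm_apply_le {A B C : Type*} [NormedAddCommGroup A]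
    [NormedAddCommGroup B] [NormedSpace ℝ B] [NormedAddCommGroup C] [NormedSpace ℝ C]
    {S : Set A} {D : A → (B →L[ℝ] C)} {y : A} (hy : y ∈ S)
    (hD : ContinuousOn (fun p : A × B => D p.1 p.2) (S ×ˢ univ)) :
    ∃ c > 0, ∀ᶠ z in 𝓝[S] y, ∀ k, ‖D z k‖ ≤ c * ‖k‖ := by
  have h0 := (hD (y, 0) ⟨hy, mem_univ _⟩).norm
  have h1 : ∀ᶠ p in 𝓝[S ×ˢ univ] (y, (0 : B)), ‖D p.1 p.2‖ < 1 := by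
    refine h0.eventually_lt_const ?_
    simp
  rw [nhdsWithin_prod_eq, nhdsWithin_univ] at h1
  obtain ⟨P, hP, Q, hQ, hPQ⟩ := eventually_prod_iff.1 h1
  obtain ⟨r, hr, hrQ⟩ := Metric.eventually_nhds_iff.1 hQ
  -- A unit vector scaled to length `r / 2` lies in the ball where the image has norm less than `1`.
  refine ⟨2 / r, by positivity, hP.mono fun z hz k => ?_⟩
  have hb : ‖D z‖ ≤ 2 / r := by
    refine ContinuousLinearMap.opNorm_le_of_unit_norm (by positivity) fun x hx => ?_
    have hxr : ‖(r / 2) • x‖ = r / 2 := by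
      rw [norm_smul, hx, mul_one, Real.norm_of_nonneg (by positivity)]
    have h2 : ‖D z ((r / 2) • x)‖ < 1 :=
      hPQ hz (hrQ (by rw [dist_zero_right, hxr]; exact half_lt_self hr))
    rw [map_smul, norm_smul, Real.norm_of_nonneg (by positivity)] at h2
    rw [le_div_iff₀ hr]
    linarith
  exact (D z).le_of_opNorm_le hb k

/-- If `(y, k) ↦ D y k` is continuous and `L` is compact, then `y ↦ D y ∘ L` is continuous in the
operator norm. -/
theorem eventually_norm_sub_apply_le {A B C A' : Type*} [NormedAddCommGroup A]
    [NormedAddCommGroup B] [NormedSpace ℝ B] [NormedAddCommGroup C] [NormedSpace ℝ C]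
    [NormedAddCommGroup A'] [NormedSpace ℝ A']
    {S : Set A} {D : A → (B →L[ℝ] C)} {y : A} (hy : y ∈ S)
    (hD : ContinuousOn (fun p : A × B => D p.1 p.2) (S ×ˢ univ))
    {L : A' →L[ℝ] B} (hL : IsCompactOperator L) {ε : ℝ} (hε : 0 < ε) :
    ∀ᶠ z in 𝓝[S] y, ∀ h, ‖D z (L h) - D y (L h)‖ ≤ ε * ‖h‖ := by
  obtain ⟨K, hK, hLK⟩ :=
    IsCompactOperator.image_closedBall_subset_compact (f := (L : A' →ₗ[ℝ] B)) hL 1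
  -- Pointwise convergence `D z → D y` is uniform on the compact set `K`, which contains the image
  -- of the unit ball.
  obtain ⟨s, hs, hsK⟩ := hK.mem_uniformity_of_prod (f := fun z k => D z k)
    (hD.mono (prod_mono_right (subset_univ K))) hy (Metric.dist_mem_uniformity hε)
  filter_upwards [hs] with z hz h
  have hb : ‖(D z - D y).comp L‖ ≤ ε := by
    refine ContinuousLinearMap.opNorm_le_of_unit_norm hε.le fun x hx => ?_
    have := hsK z hz (L x) (hLK ⟨x, by simp [hx], rfl⟩)
    rw [mem_ofPred_eq, dist_eq_norm] at this
    exact this.le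
  exact ContinuousLinearMap.le_of_opNorm_le _ hb h

/-- The intersection of a convex set with an open set. -/
def IsOpenInConvex {A : Type*} [NormedAddCommGroup A] [NormedSpace ℝ A] (V : Set A) : Prop :=
  ∃ C G : Set A, Convex ℝ C ∧ IsOpen G ∧ V = C ∩ G

theorem IsOpenInConvex.univ {A : Type*} [NormedAddCommGroup A] [NormedSpace ℝ A] :
    IsOpenInConvex (univ : Set A) :=
  ⟨_, _, convex_univ, isOpen_univ, (inter_self _).symm⟩

theorem IsOpenInConvex.preimage {A B : Type*} [NormedAddCommGroup A] [NormedSpace ℝ A]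
    [NormedAddCommGroup B] [NormedSpace ℝ B] {V : Set B} (hV : IsOpenInConvex V) (L : A →L[ℝ] B) :
    IsOpenInConvex (L ⁻¹' V) := by
  obtain ⟨C, G, hC, hG, rfl⟩ := hV
  exact ⟨_, _, hC.linear_preimage L.toLinearMap, hG.preimage L.continuous, rfl⟩

theorem IsOpenInConvex.tangentSet {E : BanachScale.{u}} {U : Set (E.level 0)}
    (hU : IsOpenInConvex U) : IsOpenInConvex (tangentSet U) :=
  hU.preimage (A := E.tangent.level 0)
    ((E.emb 1).comp (ContinuousLinearMap.fst ℝ (E.level 1) (E.level 0)))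

theorem IsOpenInConvex.exists_ball {A : Type*} [NormedAddCommGroup A] [NormedSpace ℝ A]
    {V : Set A} (hV : IsOpenInConvex V) {y : A} (hy : y ∈ V) {s : Set A} (hs : s ∈ 𝓝[V] y) :
    ∃ r > 0, ∀ z ∈ V, dist z y < r → segment ℝ y z ⊆ V ∩ s := by
  obtain ⟨C, G, hC, hG, rfl⟩ := hV
  obtain ⟨r, hr, hrG⟩ := Metric.mem_nhds_iff.1 (hG.mem_nhds hy.2)
  obtain ⟨r', hr', hrs⟩ := Metric.mem_nhdsWithin_iff.1 hs
  refine ⟨min r r', lt_min hr hr', fun z hz hzr => ?_⟩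
  have hb : segment ℝ y z ⊆ Metric.ball y (min r r') :=
    (convex_ball _ _).segment_subset (Metric.mem_ball_self (lt_min hr hr')) hzr
  have hV : segment ℝ y z ⊆ C ∩ G := fun p hp =>
    ⟨hC.segment_subset hy.1 hz.1 hp, hrG (Metric.ball_subset_ball (min_le_left _ _) (hb hp))⟩
  exact fun p hp => ⟨hV hp, hrs ⟨Metric.ball_subset_ball (min_le_right _ _) (hb hp), hV hp⟩⟩

variable {E : BanachScale.{u}} {F : BanachScale.{v}} {G : BanachScale.{w}} {U : Set (E.level 0)}
  {V : Set (F.level 0)} {f : E.level 0 → F.level 0} {g : F.level 0 → G.level 0}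

/-- Put `δ = f (x + h) - f x`. As an element of `F 1` it is only known to be small, by continuity;
the expansion `δ = Df x h + o(‖h‖₁)` holds in `F 0`. The mean value inequality is therefore applied
to `g` along the segment from `f x` to `f x + δ` in `F 1`, which stays in `V` by convexity, with the
derivative error split as `Dg z (δ - Df x h) + (Dg z - Dg (f x)) (Df x h)`. Local boundedness of
`Dg` controls the first term; the second is controlled because `h ↦ Df x h` is compact on `E 1`,
although `Dg` need not be continuous in operator norm. -/
theorem IsTangentMapOn.comp (hE : E.CompactIncl) (hV : IsOpenInConvex V)
    {Tf : E.tangent.level 0 → F.tangent.level 0} {Tg : F.tangent.level 0 → G.tangent.level 0}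
    (hf0 : ScZeroOn U f) (hTf : IsTangentMapOn U f Tf) (hTg : IsTangentMapOn V g Tg)
    (hTg0 : ContinuousOn Tg (tangentSet V)) (hUV : MapsTo f U V) :
    IsTangentMapOn U (g ∘ f) (Tg ∘ Tf) := by
  obtain ⟨Df, hDf, hTf⟩ := hTf
  obtain ⟨Dg, hDg, hTg⟩ := hTg
  obtain ⟨f₁, hf₁, hff₁⟩ := hf0 1
  have hmem : ∀ x, E.emb 1 x ∈ U → F.emb 1 (f₁ x) ∈ V := fun x hx => by
    rw [hff₁ x hx]; exact hUV hx
  have hTf1 : ∀ x h, E.emb 1 x ∈ U → (Tf (x, h)).1 = f₁ x := fun x h hx =>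
    F.emb_injective 1 ((hTf x h hx).1.trans (hff₁ x hx).symm)
  refine ⟨fun x => (Dg (f₁ x)).comp (Df x), fun x hx => ?_, fun x h hx => ?_⟩
  · set y := f₁ x with hy
    have hfy : F.emb 1 y = f (E.emb 1 x) := hff₁ x hx
    set S := F.emb 1 ⁻¹' V with hS
    have hyS : y ∈ S := hmem x hx
    have hDcont : ContinuousOn (fun p : F.level 1 × F.level 0 => Dg p.1 p.2) (S ×ˢ univ) := by
      refine ContinuousOn.congr (f := fun p => (Tg p).2)
        (continuous_snd.comp_continuousOn (hTg0.mono fun p hp => hp.1)) ?_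
      rintro ⟨z, k⟩ hp
      exact (hTg z k hp.1).2.symm
    set L : E.level 1 →L[ℝ] F.level 0 := (Df x).comp (E.emb 1) with hL
    have hLc : IsCompactOperator L := by
      have : IsCompactOperator (E.incl 0) := hE 0
      exact this.clm_comp (Df x)
    obtain ⟨c, hc, hbd⟩ := eventually_norm_apply_le hyS hDcont
    rw [hasFDerivWithinAt_iff_isLittleO, Asymptotics.isLittleO_iff]
    intro ε hε
    have hnear := eventually_norm_sub_apply_le hyS hDcont hLc (half_pos hε)
    obtain ⟨r, hr, hrS⟩ := (hV.preimage (F.emb 1)).exists_ball hyS (hbd.and hnear)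
    have hfx := hDf x hx
    rw [hasFDerivWithinAt_iff_isLittleO, Asymptotics.isLittleO_iff] at hfx
    -- After multiplication by the bound `c` on the operators, this remainder contributes `ε / 2`.
    have hfx := hfx (show 0 < ε / (2 * c) by positivity)
    have hcl : ∀ᶠ x' in 𝓝[E.emb 1 ⁻¹' U] x, dist (f₁ x') y < r :=
      (hf₁ x hx).eventually (Metric.ball_mem_nhds _ hr)
    filter_upwards [hfx, hcl, self_mem_nhdsWithin] with x' hx' hr' hxU'
    have hseg := hrS _ (hmem x' hxU') hr'
    set δ := f₁ x' - y with hδ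
    have e1 : y + δ = f₁ x' := by rw [hδ]; abel
    have hyt : ∀ t ∈ Icc (0 : ℝ) 1, y + t • δ ∈ segment ℝ y (f₁ x') := fun t ht => by
      rw [segment_eq_image']
      exact ⟨t, ht, by rw [hδ]⟩
    have hδe : F.emb 1 δ = f (E.emb 1 x') - f (E.emb 1 x) := by
      rw [hδ, map_sub, hff₁ x' hxU', hfy]
    clear_value δ
    -- Subtracting the linear term makes the increment over `[0, 1]` exactly the remainder to be
    -- estimated.
    have hder : ∀ t ∈ Icc (0 : ℝ) 1, HasDerivWithinAt
        (fun t : ℝ => g (F.emb 1 (y + t • δ)) - t • Dg y (L (x' - x)))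
        (Dg (y + t • δ) (F.emb 1 δ) - Dg y (L (x' - x))) (Icc 0 1) t := by
      intro t ht
      have h1 : HasDerivWithinAt (fun t : ℝ => y + t • δ) δ (Icc 0 1) t := by
        simpa using (((hasDerivAt_id t).smul_const δ).const_add y).hasDerivWithinAt
      have h2 := (hDg (y + t • δ) (hseg (hyt t ht)).1).comp_hasDerivWithinAt t h1
        fun s hs => (hseg (hyt s hs)).1
      have h3 : HasDerivWithinAt (fun t : ℝ => t • Dg y (L (x' - x))) (Dg y (L (x' - x)))
          (Icc 0 1) t := by
        simpa using ((hasDerivAt_id t).smul_const (Dg y (L (x' - x)))).hasDerivWithinAt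
      exact h2.sub h3
    have hle := norm_image_sub_le_of_norm_deriv_le_segment_01' (C := ε * ‖x' - x‖) hder ?_
    · simp only [zero_smul, add_zero, sub_zero, one_smul] at hle
      rw [e1, hff₁ x' hxU', hfy, sub_right_comm] at hle
      exact hle
    · intro t ht
      obtain ⟨ht1, ht2, ht3⟩ := hseg (hyt t (Ico_subset_Icc_self ht))
      have e : Dg (y + t • δ) (F.emb 1 δ) - Dg y (L (x' - x)) =
          Dg (y + t • δ) (F.emb 1 δ - L (x' - x)) +
            (Dg (y + t • δ) (L (x' - x)) - Dg y (L (x' - x))) := by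
        rw [(Dg (y + t • δ)).map_sub]; abel
      have h1 := ht2 (F.emb 1 δ - L (x' - x))
      have h2 := ht3 (x' - x)
      rw [hδe] at h1 e
      rw [hδe, e]
      refine (norm_add_le _ _).trans ?_
      have h3 := mul_le_mul_of_nonneg_left hx' hc.le
      have e3 : c * (ε / (2 * c) * ‖x' - x‖) = ε / 2 * ‖x' - x‖ := by
        field_simp
      rw [e3] at h3
      have := h1.trans h3
      linarith
  · obtain ⟨h1, h2⟩ := hTf x h hx
    have h3 := hTg (Tf (x, h)).1 (Tf (x, h)).2 (by rw [h1]; exact hUV hx)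
    refine ⟨h3.1.trans (by rw [h1]; rfl), h3.2.trans ?_⟩
    rw [h2, hTf1 x h hx]
    rfl

/-- The chain rule. -/
theorem ScClassOn.comp {k : ℕ} (hE : E.CompactIncl) (hV : IsOpenInConvex V)
    (hg : ScClassOn k V g) (hf : ScClassOn k U f) (hUV : MapsTo f U V) :
    ScClassOn k U (g ∘ f) := by
  induction k generalizing E F G with
  | zero => exact ScZeroOn.comp hg hf hUV
  | succ k ih =>
    obtain ⟨hg0, Tg, hTg, hgk⟩ := hg
    obtain ⟨hf0, Tf, hTf, hfk⟩ := hf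
    refine ⟨hg0.comp hf0 hUV, Tg ∘ Tf,
      hTf.comp hE hV hf0 hTg hgk.scZeroOn.continuousOn hUV,
      ih hE.tangent hV.tangentSet hgk hfk ?_⟩
    rintro ⟨x, h⟩ hx
    obtain ⟨D, -, hD⟩ := hTf
    change F.emb 1 (Tf (x, h)).1 ∈ V
    rw [(hD x h hx).1]
    exact hUV hx

theorem ScSmoothOn.comp (hE : E.CompactIncl) (hV : IsOpenInConvex V)
    (hg : ScSmoothOn V g) (hf : ScSmoothOn U f) (hUV : MapsTo f U V) : ScSmoothOn U (g ∘ f) :=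
  fun k => (hg k).comp hE hV (hf k) hUV

theorem ScZeroOn.prodMk {f : E.level 0 → F.level 0} {g : E.level 0 → G.level 0}
    (hf : ScZeroOn U f) (hg : ScZeroOn U g) :
    ScZeroOn (F := F.prod G) U (fun x => (f x, g x)) := fun m => by
  obtain ⟨a, ha, haf⟩ := hf m
  obtain ⟨b, hb, hbg⟩ := hg m
  refine ⟨fun x => (a x, b x), ha.prodMk hb, fun x hx => ?_⟩
  rw [emb_prod, haf x hx, hbg x hx]

theorem ScClassOn.prodMk {k : ℕ} (hE : E.CompactIncl) {f : E.level 0 → F.level 0}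
    {g : E.level 0 → G.level 0} (hf : ScClassOn k U f) (hg : ScClassOn k U g) :
    ScClassOn (F := F.prod G) k U (fun x => (f x, g x)) := by
  induction k generalizing E F G with
  | zero => exact ScZeroOn.prodMk hf hg
  | succ k ih =>
    obtain ⟨hf0, Tf, hTf, hfk⟩ := hf
    obtain ⟨hg0, Tg, hTg, hgk⟩ := hg
    refine ⟨hf0.prodMk hg0, fun p => (((Tf p).1, (Tg p).1), ((Tf p).2, (Tg p).2)), ?_, ?_⟩
    · obtain ⟨D, hD, hDf⟩ := hTf
      obtain ⟨D', hD', hDg⟩ := hTg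
      refine ⟨fun x => (D x).prod (D' x), fun x hx => (hD x hx).prodMk (hD' x hx),
        fun x h hx => ⟨?_, ?_⟩⟩
      · rw [emb_prod, (hDf x h hx).1, (hDg x h hx).1]
      · exact Prod.ext (hDf x h hx).2 (hDg x h hx).2
    -- The tangent map of the pair is the pair of tangent maps followed by a linear permutation of
    -- the four components.
    · have hk := ih hE.tangent (F := F.tangent) (G := G.tangent) hfk hgk
      have hs : ScSmoothOn (E := F.tangent.prod G.tangent) (F := (F.prod G).tangent) univ
          (fun q => ((q.1.1, q.2.1), (q.1.2, q.2.2))) := by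
        refine scSmoothOn_of_contDiff univ (fun m q => ((q.1.1, q.2.1), (q.1.2, q.2.2)))
          (fun m => ?_) fun m q => ?_
        · fun_prop
        · rw [emb_prod F.tangent, emb_tangent, emb_tangent, emb_tangent]
          exact Prod.ext (emb_prod F.shift G.shift m _) (emb_prod F G m _)
      exact (hs k).comp hE.tangent .univ hk (mapsTo_univ _ _)

theorem ScSmoothOn.prodMk (hE : E.CompactIncl) {f : E.level 0 → F.level 0}
    {g : E.level 0 → G.level 0} (hf : ScSmoothOn U f) (hg : ScSmoothOn U g) :
    ScSmoothOn (F := F.prod G) U (fun x => (f x, g x)) :=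
  fun k => (hf k).prodMk hE (hg k)

end ChainRule

end BanachScale

open Filter
open scoped ContDiff

/-! ### Hilbert norms and sc-smooth maps on splicing cores. -/

namespace BanachScale

theorem IsPartialQuadrant.convex {W : BanachScale.{u}} {C : Set (W.level 0)}
    (h : W.IsPartialQuadrant C) : Convex ℝ C := by
  obtain ⟨n, Q, T, -, hT⟩ := h
  have hC : C = T.toEquiv 0 ⁻¹' {p | ∀ i, 0 ≤ p.1 i} := by
    rw [← hT, preimage_image_eq _ (T.toEquiv 0).injective]
  rw [hC]
  refine Convex.linear_preimage ?_ (T.toEquiv 0).toLinearEquiv.toLinearMap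
  intro p hp q hq a b ha hb _ i
  exact add_nonneg (mul_nonneg ha (hp i)) (mul_nonneg hb (hq i))

theorem IsHilbert.contDiff_norm_sq {E : BanachScale.{u}} (hE : E.IsHilbert) :
    ContDiff ℝ ∞ fun x : E.level 0 => ‖x‖ ^ 2 := by
  -- The normed-space instance is made a variable so that it can be replaced by the one coming from
  -- the inner product.
  have key : ∀ {A : Type u} [NormedAddCommGroup A] [inst : NormedSpace ℝ A],
      (∃ I : InnerProductSpace ℝ A, I.toNormedSpace = inst) →
        ContDiff ℝ ∞ fun x : A => ‖x‖ ^ 2 := by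
    rintro A _ _ ⟨I, rfl⟩
    exact _root_.contDiff_norm_sq ℝ
  exact key hE

end BanachScale

open BanachScale

namespace ScSplicing

variable (S : ScSplicing.{w})

theorem compactIncl_ambient : S.ambient.CompactIncl :=
  CompactIncl.prod S.isSc_W.compact S.isSc_E.compact

theorem retr_mem_core {p : S.ambient.level 0} (hp : p.1 ∈ S.V) : S.retr p ∈ S.core :=
  ⟨hp, congrArg (fun L => L p.2) (S.proj p.1 hp)⟩

variable {S} in
theorem retr_eq {p : S.ambient.level 0} (hp : p ∈ S.core) : S.retr p = p :=
  Prod.ext rfl hp.2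

variable {S} in
theorem mem_hat {O : Set (S.ambient.level 0)} (hO : O ⊆ S.core) {p : S.ambient.level 0}
    (hp : p ∈ O) : p ∈ S.hat O :=
  ⟨(hO hp).1, by rwa [retr_eq (hO hp)]⟩

theorem hat_mono {O O' : Set (S.ambient.level 0)} (h : O ⊆ O') : S.hat O ⊆ S.hat O' :=
  fun _ hp => ⟨hp.1, h hp.2⟩

theorem scSmoothOn_retr :
    BanachScale.ScSmoothOn (E := S.ambient) (F := S.ambient) (S.V ×ˢ univ) S.retr :=
  BanachScale.ScSmoothOn.prodMk S.compactIncl_ambient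
    (scSmoothOn_of_clm _ (fun m => ContinuousLinearMap.fst ℝ (S.W.level m) (S.E.level m))
      fun m x => by rw [emb_prod]; rfl) S.smooth

/-- The retraction is continuous on `V ⊕ E`, and `V` is open in the convex set `C`. This provides
the segments that the chain rule needs. -/
theorem isOpenInConvex_hat {O : Set (S.ambient.level 0)}
    (hO : ∃ G : Set (S.ambient.level 0), IsOpen G ∧ O = S.core ∩ G) :
    IsOpenInConvex (S.hat O) := by
  obtain ⟨G, hG, rfl⟩ := hO
  obtain ⟨G', hG', hV⟩ := S.isOpen_V
  obtain ⟨H, hH, hHG⟩ := continuousOn_iff'.1 S.scSmoothOn_retr.continuousOn G hG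
  refine ⟨Prod.fst ⁻¹' S.C, Prod.fst ⁻¹' G' ∩ H,
    S.isPartialQuadrant.convex.linear_preimage (LinearMap.fst ℝ (S.W.level 0) (S.E.level 0)),
    (hG'.preimage continuous_fst).inter hH, ?_⟩
  ext p
  have h1 : p.1 ∈ S.V ↔ p.1 ∈ S.C ∧ p.1 ∈ G' := by rw [hV]; rfl
  have h2 : p.1 ∈ S.V → (S.retr p ∈ G ↔ p ∈ H) := fun hp => by
    have := Set.ext_iff.1 hHG p
    simpa [hp] using this
  constructor
  · rintro ⟨hp, -, hpG⟩
    exact ⟨(h1.1 hp).1, (h1.1 hp).2, (h2 hp).1 hpG⟩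
  · rintro ⟨hpC, hpG', hpH⟩
    have hp := h1.2 ⟨hpC, hpG'⟩
    exact ⟨hp, S.retr_mem_core hp, (h2 hp).2 hpH⟩

variable {S} {F : BanachScale.{v}} {O O' : Set (S.ambient.level 0)}
  {f f' : S.ambient.level 0 → F.level 0}

theorem ScSmoothOn.mono (h : S.ScSmoothOn O f) (hO : O' ⊆ O) : S.ScSmoothOn O' f :=
  BanachScale.ScSmoothOn.mono h (S.hat_mono hO)

theorem ScSmoothOn.congr (h : S.ScSmoothOn O f) (hf : EqOn f' f O) : S.ScSmoothOn O f' :=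
  BanachScale.ScSmoothOn.congr h fun _ hp => hf hp.2

theorem ScSmoothOn.continuousOn (h : S.ScSmoothOn O f) (hO : O ⊆ S.core) : ContinuousOn f O :=
  ContinuousOn.congr ((BanachScale.ScSmoothOn.continuousOn h).mono fun _ hp => mem_hat hO hp)
    fun p hp => by rw [retr_eq (hO hp)]

/-- The restriction to the splicing core of an sc-smooth map on the sc-Banach space. -/
theorem scSmoothOn_of_ambient (h : BanachScale.ScSmoothOn univ f) : S.ScSmoothOn O f :=
  BanachScale.ScSmoothOn.comp S.compactIncl_ambient .univ h
    (S.scSmoothOn_retr.mono fun _ hp => ⟨hp.1, mem_univ _⟩) (mapsTo_univ _ _)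

/-- With retractions `r` and `r'`, one has `g ∘ h ∘ r = (g ∘ r') ∘ (h ∘ r)`, since `h` takes values
in the second core, which `r'` fixes. -/
theorem ScSmoothOn.comp {S' : ScSplicing.{w}} {Q : Set (S'.ambient.level 0)}
    {g : S'.ambient.level 0 → F.level 0} {h : S.ambient.level 0 → S'.ambient.level 0}
    (hQ : ∃ G : Set (S'.ambient.level 0), IsOpen G ∧ Q = S'.core ∩ G)
    (hg : S'.ScSmoothOn Q g) (hh : S.ScSmoothOn (F := S'.ambient) O h) (hO : MapsTo h O Q) :
    S.ScSmoothOn O (g ∘ h) := by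
  have hQc : Q ⊆ S'.core := by
    obtain ⟨G, -, rfl⟩ := hQ
    exact inter_subset_left
  have := BanachScale.ScSmoothOn.comp S.compactIncl_ambient (S'.isOpenInConvex_hat hQ) hg hh
    fun p hp => mem_hat hQc (hO hp.2)
  refine BanachScale.ScSmoothOn.congr this fun p hp => ?_
  change g (h (S.retr p)) = g (S'.retr (h (S.retr p)))
  rw [retr_eq (hQc (hO hp.2))]

/-- Smooth functions of two sc-smooth real functions are sc-smooth. -/
theorem ScSmoothOn.comp₂ {f g : S.ambient.level 0 → ℝ}
    (hf : S.ScSmoothOn (F := const ℝ) O f) (hg : S.ScSmoothOn (F := const ℝ) O g)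
    {φ : ℝ × ℝ → ℝ} (hφ : ContDiff ℝ ∞ φ) :
    S.ScSmoothOn (F := const ℝ) O fun p => φ (f p, g p) := by
  have h : BanachScale.ScSmoothOn (E := (const ℝ).prod (const ℝ)) (F := const ℝ) univ φ :=
    scSmoothOn_of_contDiff univ (fun _ => φ) (fun _ => hφ) fun m x => by
      rw [emb_const, emb_prod, emb_const, emb_const]
  exact h.comp S.compactIncl_ambient .univ
    (BanachScale.ScSmoothOn.prodMk S.compactIncl_ambient hf hg) (mapsTo_univ _ _)

theorem scSmoothOn_const (a : ℝ) : S.ScSmoothOn (F := const ℝ) O fun _ => a :=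
  scSmoothOn_of_contDiff _ (fun _ _ => a) (fun _ => contDiff_const) fun m _ => emb_const ℝ m a

theorem IsHilbert.scSmoothOn_norm_sq (hS : S.IsHilbert) (q : S.ambient.level 0) {φ : ℝ → ℝ}
    (hφ : ContDiff ℝ ∞ φ) : S.ScSmoothOn (F := const ℝ) O
      fun p => φ (‖p.1 - q.1‖ ^ 2 + ‖p.2 - q.2‖ ^ 2) := by
  apply scSmoothOn_of_ambient
  refine scSmoothOn_of_contDiff univ (fun m p => φ
    (‖(S.ambient.emb m p).1 - q.1‖ ^ 2 + ‖(S.ambient.emb m p).2 - q.2‖ ^ 2)) (fun m => ?_)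
    fun m p => emb_const ℝ m _
  have h1 := (S.ambient.emb m).contDiff (n := ∞)
  exact hφ.comp ((hS.1.contDiff_norm_sq.comp ((contDiff_fst.comp h1).sub contDiff_const)).add
    (hS.2.contDiff_norm_sq.comp ((contDiff_snd.comp h1).sub contDiff_const)))

end ScSplicing

/-! ### Local sc-smoothness and bump functions on an M-polyfold. -/

namespace MPolyfoldChart

variable {X : Type u} [TopologicalSpace X]

theorem target_subset_core (c : MPolyfoldChart.{u, w} X) : c.map.target ⊆ c.model.core := by
  obtain ⟨G, -, h⟩ := c.isOpen_target
  exact h ▸ inter_subset_left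

/-- The restriction of a chart to an open set. -/
def restr (c : MPolyfoldChart.{u, w} X) {N : Set X} (hN : IsOpen N) : MPolyfoldChart.{u, w} X where
  model := c.model
  map := c.map.restr N
  isOpen_source := c.isOpen_source.inter hN
  isOpen_target := by
    obtain ⟨G, hG, hcG⟩ := c.isOpen_target
    obtain ⟨G', hG', h⟩ := continuousOn_iff'.1 c.continuousOn_symm N hN
    refine ⟨G ∩ G', hG.inter hG', ?_⟩
    rw [PartialEquiv.restr_target, inter_comm, h, hcG, inter_comm, inter_assoc]
  continuousOn_map := c.continuousOn_map.mono inter_subset_left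
  continuousOn_symm := c.continuousOn_symm.mono inter_subset_left

end MPolyfoldChart

namespace MPolyfoldStructure

variable {X : Type u} [TopologicalSpace X] (P : MPolyfoldStructure.{u, w} X)

theorem restr_mem_atlas {c : MPolyfoldChart.{u, w} X} (hc : c ∈ P.atlas) {N : Set X}
    (hN : IsOpen N) : c.restr hN ∈ P.atlas := by
  refine P.maximal _ fun c' hc' => ?_
  obtain ⟨h1, h2⟩ := P.compatible c hc c' hc'
  exact ⟨ScSplicing.ScSmoothOn.mono h1 (image_mono (inter_subset_inter_left _ inter_subset_left)),
    ScSplicing.ScSmoothOn.mono h2 (image_mono (inter_subset_inter_right _ inter_subset_left))⟩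

/-- The function `f` is sc-smooth near `x`. -/
def ScSmoothAt (f : X → ℝ) (x : X) : Prop :=
  ∃ c ∈ P.atlas, x ∈ c.map.source ∧
    c.model.ScSmoothOn (F := const ℝ) c.map.target fun p => f (c.map.symm p)

variable {P} {f g : X → ℝ} {x : X}

theorem ScSmoothAt.congr (hf : P.ScSmoothAt f x) (h : g =ᶠ[𝓝 x] f) : P.ScSmoothAt g x := by
  obtain ⟨c, hc, hx, hf⟩ := hf
  obtain ⟨N, hNg, hN, hxN⟩ := eventually_nhds_iff.1 h
  refine ⟨c.restr hN, P.restr_mem_atlas hc hN, ⟨hx, hxN⟩, ?_⟩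
  exact (hf.mono (O' := (c.restr hN).map.target) inter_subset_left).congr fun p hp => hNg _ hp.2

theorem scSmoothAt_const (a : ℝ) (x : X) : P.ScSmoothAt (fun _ => a) x := by
  obtain ⟨c, hc, hx⟩ := P.cover x
  exact ⟨c, hc, hx, ScSplicing.scSmoothOn_const a⟩

theorem ScSmoothAt.comp₂ (hf : P.ScSmoothAt f x) (hg : P.ScSmoothAt g x) {φ : ℝ × ℝ → ℝ}
    (hφ : ContDiff ℝ ∞ φ) : P.ScSmoothAt (fun y => φ (f y, g y)) x := by
  obtain ⟨c, hc, hx, hf⟩ := hf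
  obtain ⟨c', hc', hx', hg⟩ := hg
  refine ⟨c.restr c'.isOpen_source, P.restr_mem_atlas hc _, ⟨hx, hx'⟩, ?_⟩
  have himg : (c.restr c'.isOpen_source).map.target ⊆
      c.map '' (c.map.source ∩ c'.map.source) := fun p hp =>
    ⟨c.map.symm p, ⟨c.map.map_target hp.1, hp.2⟩, c.map.right_inv hp.1⟩
  -- The functions may be given in different charts; the transition map moves `g` into the chart of
  -- `f`.
  have ht := ScSplicing.ScSmoothOn.mono (P.compatible c hc c' hc').1 himg
  have hg' := hg.comp c'.isOpen_target ht fun p hp => c'.map.map_source hp.2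
  refine ScSplicing.ScSmoothOn.comp₂ (hf.mono (O' := (c.restr c'.isOpen_source).map.target)
    inter_subset_left) (hg'.congr fun p hp => ?_) hφ
  exact congrArg g (c'.map.left_inv hp.2).symm

theorem ScSmoothAt.add (hf : P.ScSmoothAt f x) (hg : P.ScSmoothAt g x) :
    P.ScSmoothAt (fun y => f y + g y) x :=
  hf.comp₂ hg (contDiff_fst.add contDiff_snd)

theorem ScSmoothAt.mul (hf : P.ScSmoothAt f x) (hg : P.ScSmoothAt g x) :
    P.ScSmoothAt (fun y => f y * g y) x :=
  hf.comp₂ hg (contDiff_fst.mul contDiff_snd)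

theorem ScSmoothAt.one_sub (hf : P.ScSmoothAt f x) : P.ScSmoothAt (fun y => 1 - f y) x :=
  hf.comp₂ hf (contDiff_const.sub contDiff_fst)

theorem ScSmoothAt.finset_sum {ι : Type*} (s : Finset ι) {F : ι → X → ℝ}
    (hF : ∀ i ∈ s, P.ScSmoothAt (F i) x) : P.ScSmoothAt (fun y => ∑ i ∈ s, F i y) x := by
  classical
  induction s using Finset.induction_on with
  | empty => simpa using scSmoothAt_const 0 x
  | insert i s hi ih =>
    simp only [Finset.sum_insert hi]
    exact (hF i (by simp)).add (ih fun j hj => hF j (by simp [hj]))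

theorem ScSmoothAt.finset_prod {ι : Type*} (s : Finset ι) {F : ι → X → ℝ}
    (hF : ∀ i ∈ s, P.ScSmoothAt (F i) x) : P.ScSmoothAt (fun y => ∏ i ∈ s, F i y) x := by
  classical
  induction s using Finset.induction_on with
  | empty => simpa using scSmoothAt_const 1 x
  | insert i s hi ih =>
    simp only [Finset.prod_insert hi]
    exact (hF i (by simp)).mul (ih fun j hj => hF j (by simp [hj]))

theorem ScSmoothAt.continuousAt (hf : P.ScSmoothAt f x) : ContinuousAt f x := by
  obtain ⟨c, hc, hx, hf⟩ := hf
  have h1 := (hf.continuousOn c.target_subset_core).comp c.continuousOn_map c.map.mapsTo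
  have h2 : ContinuousOn f c.map.source := h1.congr fun y hy => by
    simp [c.map.left_inv hy]
  exact h2.continuousAt (c.isOpen_source.mem_nhds hx)

theorem ScSmooth.continuous (hf : P.ScSmooth f) : Continuous f :=
  continuous_iff_continuousAt.2 fun x => ScSmoothAt.continuousAt (hf x)

open scoped Classical in
/-- Sc-smooth bump functions on an M-polyfold modelled on sc-Hilbert spaces. -/
theorem IsHilbert.exists_bump [RegularSpace X] (hP : P.IsHilbert) {U : Set X} (hU : U ∈ 𝓝 x) :
    ∃ f : X → ℝ, P.ScSmooth f ∧ (∀ y, f y ∈ Icc (0 : ℝ) 1) ∧ f =ᶠ[𝓝 x] 1 ∧ tsupport f ⊆ U := by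
  obtain ⟨c, hc, hx, hcH⟩ := hP x
  have hsU : c.map.source ∩ U ∈ 𝓝 x := inter_mem (c.isOpen_source.mem_nhds hx) hU
  -- `N` is closed in `X`: a closed ball of the model need not pull back to a closed subset of `X`,
  -- so the support is confined by `N` instead.
  obtain ⟨N, hN, hNc, hNU⟩ := exists_mem_nhds_isClosed_subset hsU
  obtain ⟨N', hN'N, hN', hxN'⟩ := mem_nhds_iff.1 hN
  set q := c.map x with hq
  have hqt : q ∈ c.map.target := c.map.map_source hx
  obtain ⟨r, hr, hrN⟩ : ∃ r > 0, ∀ y ∈ c.map.source, dist (c.map y) q < r → y ∈ N := by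
    have h1 : c.map.symm ⁻¹' N' ∈ 𝓝[c.map.target] q :=
      c.continuousOn_symm q hqt (hN'.mem_nhds (by rwa [hq, c.map.left_inv hx]))
    obtain ⟨r, hr, h⟩ := Metric.mem_nhdsWithin_iff.1 h1
    refine ⟨r, hr, fun y hy hyr => hN'N ?_⟩
    have := h ⟨hyr, c.map.map_source hy⟩
    rwa [mem_preimage, c.map.left_inv hy] at this
  -- `φ` is `1` for `t ≤ r² / 2` and `0` for `t ≥ r²`. Below, `D < r²` bounds both components by
  -- `r`, hence also the sup distance on the product.
  set φ : ℝ → ℝ := fun t => Real.smoothTransition (2 - t * (2 / r ^ 2)) with hφ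
  have hφs : ContDiff ℝ ∞ φ :=
    Real.smoothTransition.contDiff.comp (contDiff_const.sub (contDiff_id.mul contDiff_const))
  set D : c.model.ambient.level 0 → ℝ := fun p => ‖p.1 - q.1‖ ^ 2 + ‖p.2 - q.2‖ ^ 2 with hD
  have hDc : Continuous D := by fun_prop
  set f : X → ℝ := fun y => if y ∈ c.map.source then φ (D (c.map y)) else 0 with hf
  have hsupp : Function.support f ⊆ N := fun y hy => by
    rw [Function.mem_support] at hy
    by_cases hys : y ∈ c.map.source
    · simp only [hf, hys, if_true, hφ] at hy
      have h1 : 0 < 2 - D (c.map y) * (2 / r ^ 2) := by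
        by_contra! h
        exact hy (Real.smoothTransition.zero_of_nonpos h)
      have h2 : D (c.map y) < r ^ 2 := by
        have : 0 < r ^ 2 := by positivity
        field_simp at h1
        linarith
      refine hrN y hys ?_
      rw [Prod.dist_eq, dist_eq_norm, dist_eq_norm]
      simp only [hD] at h2
      exact max_lt (lt_of_pow_lt_pow_left₀ 2 hr.le (by nlinarith [sq_nonneg ‖(c.map y).2 - q.2‖]))
        (lt_of_pow_lt_pow_left₀ 2 hr.le (by nlinarith [sq_nonneg ‖(c.map y).1 - q.1‖]))
    · simp [hf, hys] at hy
  have htsupp : tsupport f ⊆ N := closure_minimal hsupp hNc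
  refine ⟨f, fun y => ?_, fun y => ?_, ?_, htsupp.trans (hNU.trans inter_subset_right)⟩
  · by_cases hys : y ∈ c.map.source
    · refine ⟨c, hc, hys, (hcH.scSmoothOn_norm_sq q hφs).congr fun p hp => ?_⟩
      simp [hf, c.map.map_target hp, c.map.right_inv hp, hD]
    -- The closed support lies in the chart domain, so `f` vanishes near every point outside that
    -- domain.
    · refine (scSmoothAt_const 0 y).congr ?_
      have : y ∉ tsupport f := fun h => hys (hNU (htsupp h)).1
      exact notMem_tsupport_iff_eventuallyEq.1 this
  · simp only [hf]
    split_ifs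
    · exact ⟨Real.smoothTransition.nonneg _, Real.smoothTransition.le_one _⟩
    · simp
  · have h1 : ContinuousAt (fun y => D (c.map y)) x := hDc.continuousAt.comp
      (c.continuousOn_map.continuousAt (c.isOpen_source.mem_nhds hx))
    have h2 : ∀ᶠ y in 𝓝 x, D (c.map y) < r ^ 2 / 2 := by
      refine h1.eventually_lt_const ?_
      have h0 : D (c.map x) = 0 := by simp [hD, hq]
      simp only [h0]
      positivity
    filter_upwards [h2, c.isOpen_source.mem_nhds hx] with y hy hys
    simp only [hf, hys, if_true, hφ, Pi.one_apply]
    refine Real.smoothTransition.one_of_one_le ?_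
    have : 0 < r ^ 2 := by positivity
    field_simp
    linarith

end MPolyfoldStructure

/-! ### Telescoping products and their grouping by index. -/

open Filter

/-- The functions `b n * ∏ j < n, (1 - b j)`. -/
def telescope {X : Type*} (b : ℕ → X → ℝ) (n : ℕ) (y : X) : ℝ :=
  b n y * ∏ j ∈ Finset.range n, (1 - b j y)

section Telescope

variable {X : Type*} {b : ℕ → X → ℝ}

theorem sum_telescope (b : ℕ → X → ℝ) (y : X) (N : ℕ) :
    ∑ n ∈ Finset.range N, telescope b n y = 1 - ∏ n ∈ Finset.range N, (1 - b n y) := by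
  induction N with
  | zero => simp
  | succ N ih =>
    rw [Finset.sum_range_succ, Finset.prod_range_succ, ih, telescope]
    ring

theorem telescope_nonneg (hb : ∀ n y, b n y ∈ Icc (0 : ℝ) 1) (n : ℕ) (y : X) :
    0 ≤ telescope b n y :=
  mul_nonneg (hb n y).1 (Finset.prod_nonneg fun j _ => sub_nonneg.2 (hb j y).2)

/-- Near `x` the factor `1 - b j` is zero. It kills all later terms, and also the product by which
the partial sum differs from `1`. -/
theorem eventually_telescope_eq_zero [TopologicalSpace X] {x : X} {j : ℕ}
    (hj : b j =ᶠ[𝓝 x] 1) : ∀ᶠ y in 𝓝 x, (∀ n, j < n → telescope b n y = 0) ∧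
      ∑ n ∈ Finset.range (j + 1), telescope b n y = 1 := by
  filter_upwards [hj] with y hy
  have h : ∀ n, j < n → ∏ i ∈ Finset.range n, (1 - b i y) = 0 := fun n hn =>
    Finset.prod_eq_zero (Finset.mem_range.2 hn) (by rw [hy, Pi.one_apply, sub_self])
  refine ⟨fun n hn => ?_, ?_⟩
  · rw [telescope, h n hn, mul_zero]
  · rw [sum_telescope, h _ j.lt_succ_self, sub_zero]

end Telescope

open scoped Classical in
/-- The sum of the functions `telescope b n` over the `n` with `l n = i`. -/
noncomputable def groupedTelescope {X Λ : Type*} (b : ℕ → X → ℝ) (l : ℕ → Λ) (i : Λ) (y : X) : ℝ :=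
  ∑ᶠ n, if l n = i then telescope b n y else 0

section Grouped

variable {X Λ : Type*} {b : ℕ → X → ℝ} {l : ℕ → Λ}

theorem groupedTelescope_nonneg (hb : ∀ n y, b n y ∈ Icc (0 : ℝ) 1) (i : Λ) (y : X) :
    0 ≤ groupedTelescope b l i y :=
  finsum_nonneg fun n => by
    split_ifs
    exacts [telescope_nonneg hb n y, le_rfl]

open scoped Classical in
theorem groupedTelescope_eq_sum {y : X} {N : ℕ} (h : ∀ n, N ≤ n → telescope b n y = 0) (i : Λ) :
    groupedTelescope b l i y =
      ∑ n ∈ (Finset.range N).filter (fun n => l n = i), telescope b n y := by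
  rw [Finset.sum_filter]
  refine finsum_eq_sum_of_support_subset _ fun n hn => ?_
  by_contra hN
  refine hn ?_
  simp [h n (by simpa using hN)]

theorem finsum_groupedTelescope {y : X} {N : ℕ} (h : ∀ n, N ≤ n → telescope b n y = 0) :
    ∑ᶠ i, groupedTelescope b l i y = ∑ n ∈ Finset.range N, telescope b n y := by
  classical
  rw [finsum_eq_sum_of_support_subset (s := (Finset.range N).image l)]
  · simp only [groupedTelescope_eq_sum h]
    exact Finset.sum_fiberwise_of_maps_to (fun n hn => Finset.mem_image_of_mem l hn) _
  · intro i hi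
    rw [Function.mem_support, groupedTelescope_eq_sum h] at hi
    obtain ⟨n, hn, -⟩ := Finset.exists_ne_zero_of_sum_ne_zero hi
    rw [Finset.mem_filter] at hn
    exact Finset.mem_coe.2 (hn.2 ▸ Finset.mem_image_of_mem l hn.1)

variable [TopologicalSpace X]

theorem locallyFinite_groupedTelescope (hb : ∀ x, ∃ n, b n =ᶠ[𝓝 x] 1) :
    LocallyFinite fun i => Function.support (groupedTelescope b l i) := by
  classical
  intro x
  obtain ⟨j, hj⟩ := hb x
  refine ⟨_, eventually_telescope_eq_zero hj,
    ((Finset.range (j + 1)).image l).finite_toSet.subset ?_⟩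
  rintro i ⟨y, hyi, hy, -⟩
  rw [Function.mem_support, groupedTelescope_eq_sum hy] at hyi
  obtain ⟨n, hn, -⟩ := Finset.exists_ne_zero_of_sum_ne_zero hyi
  rw [Finset.mem_filter] at hn
  exact Finset.mem_coe.2 (hn.2 ▸ Finset.mem_image_of_mem l hn.1)

/-- For `x` outside `U i`, only finitely many terms matter near `x`, and each of those with label
`i` vanishes on a neighbourhood of `x`; the intersection of these neighbourhoods avoids the support.
-/
theorem tsupport_groupedTelescope_subset (hb : ∀ x, ∃ n, b n =ᶠ[𝓝 x] 1) {U : Λ → Set X}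
    (hU : ∀ n, tsupport (b n) ⊆ U (l n)) (i : Λ) : tsupport (groupedTelescope b l i) ⊆ U i := by
  classical
  intro x hx
  by_contra hxU
  obtain ⟨j, hj⟩ := hb x
  refine notMem_tsupport_iff_eventuallyEq.2 ?_ hx
  have h0 : ∀ n ∈ (Finset.range (j + 1)).filter (fun n => l n = i), ∀ᶠ y in 𝓝 x, b n y = 0 := by
    intro n hn
    rw [Finset.mem_filter] at hn
    exact notMem_tsupport_iff_eventuallyEq.1 fun h => hxU (hn.2 ▸ hU n h)
  filter_upwards [eventually_telescope_eq_zero hj, (Filter.eventually_all_finset _).2 h0]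
    with y hy hy0
  rw [groupedTelescope_eq_sum hy.1]
  refine Finset.sum_eq_zero fun n hn => ?_
  rw [telescope, hy0 n hn, zero_mul]

end Grouped

/-! ### Assembly of the partition of unity. -/

namespace MPolyfoldStructure

variable {X : Type u} [TopologicalSpace X] {P : MPolyfoldStructure.{u, w} X}

theorem scSmooth_telescope {b : ℕ → X → ℝ} (hb : ∀ n, P.ScSmooth (b n)) (n : ℕ) :
    P.ScSmooth (telescope b n) := fun x =>
  ScSmoothAt.mul (hb n x) (ScSmoothAt.finset_prod _ fun j _ => ScSmoothAt.one_sub (hb j x))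

theorem scSmooth_groupedTelescope {Λ : Type v} {b : ℕ → X → ℝ} {l : ℕ → Λ}
    (hs : ∀ n, P.ScSmooth (b n)) (hb : ∀ x, ∃ n, b n =ᶠ[𝓝 x] 1) (i : Λ) :
    P.ScSmooth (groupedTelescope b l i) := fun x => by
  classical
  obtain ⟨j, hj⟩ := hb x
  have h := ScSmoothAt.finset_sum ((Finset.range (j + 1)).filter fun n => l n = i)
    fun n _ => scSmooth_telescope hs n x
  refine h.congr ?_
  filter_upwards [eventually_telescope_eq_zero hj] with y hy
  exact groupedTelescope_eq_sum hy.1 i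

end MPolyfoldStructure

theorem mainTheorem10 {X : Type u} [TopologicalSpace X] [SecondCountableTopology X]
    [TopologicalSpace.MetrizableSpace X] (P : MPolyfoldStructure.{u, w} X) (hP : P.IsHilbert)
    {Λ : Type v} (U : Λ → Set X) (hU : ∀ l, IsOpen (U l)) (hcov : ⋃ l, U l = univ) :
    ∃ β : PartitionOfUnity Λ X, β.IsSubordinate U ∧ ∀ l, P.ScSmooth (β l) := by
  -- A point is needed for the countable family of bumps to be nonempty and hence enumerated by `ℕ`,
  -- possibly with repetitions.
  rcases isEmpty_or_nonempty X with hX | ⟨⟨x₀⟩⟩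
  · exact ⟨⟨fun _ => 0, fun x => hX.elim x, fun _ => le_rfl, fun x => hX.elim x,
      fun x => hX.elim x⟩, fun l x => hX.elim x, fun l x => hX.elim x⟩
  have hbump : ∀ x, ∃ l, ∃ f : X → ℝ, P.ScSmooth f ∧ (∀ y, f y ∈ Icc (0 : ℝ) 1) ∧
      f =ᶠ[𝓝 x] 1 ∧ tsupport f ⊆ U l := fun x => by
    obtain ⟨l, hl⟩ := mem_iUnion.1 (hcov ▸ mem_univ x)
    exact ⟨l, hP.exists_bump ((hU l).mem_nhds hl)⟩
  choose l f hf hI h1 hs using hbump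
  obtain ⟨s, hsc, hsu⟩ := TopologicalSpace.countable_cover_nhds fun x => interior_mem_nhds.2 (h1 x)
  obtain ⟨z, hz, -⟩ := mem_iUnion₂.1 (hsu ▸ mem_univ x₀)
  obtain ⟨e, rfl⟩ := hsc.exists_eq_range ⟨z, hz⟩
  have hb : ∀ x, ∃ n, f (e n) =ᶠ[𝓝 x] 1 := fun x => by
    obtain ⟨_, ⟨n, rfl⟩, hn⟩ := mem_iUnion₂.1 (hsu ▸ mem_univ x)
    exact ⟨n, mem_interior_iff_mem_nhds.1 hn⟩
  have hsm := MPolyfoldStructure.scSmooth_groupedTelescope (l := l ∘ e) (fun n => hf (e n)) hb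
  have hsum : ∀ x, ∑ᶠ i, groupedTelescope (f ∘ e) (l ∘ e) i x = 1 := fun x => by
    obtain ⟨j, hj⟩ := hb x
    obtain ⟨hx, hx1⟩ := (eventually_telescope_eq_zero (b := f ∘ e) hj).self_of_nhds
    rw [finsum_groupedTelescope hx]
    exact hx1
  exact ⟨⟨fun i => ⟨groupedTelescope (f ∘ e) (l ∘ e) i, (hsm i).continuous⟩,
    locallyFinite_groupedTelescope hb,
    fun i x => groupedTelescope_nonneg (fun n => hI (e n)) i x,
    fun x _ => hsum x, fun x => (hsum x).le⟩,
    tsupport_groupedTelescope_subset hb fun n => hs (e n), hsm⟩
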